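/- Let $\mathcal H$ be a complex Hilbert space of finite dimension $d\ge 2$, let $\mathcal B(\mathcal H)$ be the space of linear operators in $\mathcal H$ (that is, $d\times d$ complex matrices), with Hilbert–Schmidt scalar product $\langle A,B\rangle_{\mathrm{HS}}=\operatorname{tr}(A^*B)$, and let $\mathcal S(\mathcal H)$ be the set of density operators (positive operators of unit trace). For $\rho\in\mathcal S(\mathcal H)$ with eigenvalues $p_1,\dots,p_d$, repeated according to multiplicity, consider: - the von Neumann entropy $S_{\mathrm{vN}}(\rho)=-\sum_k p_k\ln p_k$ (with $0\ln 0=0$); - for $q>0$, the Tsallis entropies $\frac{1}{1-q}\big(\sum_k p_k^q-1\big)$ if $q\ne1$, and $S_{\mathrm{vN}}(\rho)$ if $q=1$; - for $q>0$, the Rényi entropies $\frac{1}{1-q}\ln\big(\sum_k p_k^q\big)$ if $q\neq 1$, and $S_{\mathrm{vN}}(\rho)$ if $q=1$; - for $1<p\le\infty$, the functions $1-\|\rho\|_p$, where $\|A\|_p=\big(\operatorname{tr}|A|^p\big)^{1/p}$ for $p<\infty$ and $\|A\|_\infty$ is the operator norm. Let $S$ be any one of these entropies. Let $\{\Phi_t\}_{t\ge0}$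 be a quantum dynamical semigroup on $\mathcal B(\mathcal H)$, i.e. a family of completely positive, trace-preserving linear maps with $\Phi_t\Phi_s=\Phi_{t+s}$, $\Phi_0=\mathrm{Id}$ and $\lim_{t\downarrow0}\Phi_tA=A$ for every $A$. Its infinitesimal generator is $\mathfrak L A=\lim_{t\downarrow 0}t^{-1}(\Phi_tA-A)$. The semigroup is said not to decrease $S$ if $S(\Phi_{t+s}\rho)\ge S(\Phi_t\rho)$ for all $\rho\in\mathcal S(\mathcal H)$ and all $t,s\ge0$. Then $\{\Phi_t\}_{t\ge 0}$ does not decrease $S$ if and only if its infinitesimal generator is of the form $$\mathfrak L A=-i[H,A]+\sum_{k=1}^{d^2-1}\gamma_k\Big(F_kAF_k^*-\tfrac12\big(F_k^*F_kA+AF_k^*F_k\big)\Big),\qquad A\in\mathcal B(\mathcal H),$$ where $H$ is a traceless selfadjoint operator, $\gamma_1,\dots,\gamma_{d^2-1}\ge0$, and $F_1,\dots,F_{d^2-1}$ are traceless operators such that $\langle F_j,F_k\rangle_{\mathrm{HS}}=\delta_{jk}$ for all $j,k$ and $$\sum_{k=1}^{d^2-1}\gamma_kF_kF_k^*=\sum_{k=1}^{d^2-1}\gamma_kF_k^*F_k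 .$$ -/

import Mathlib

open Filter Topology
open scoped ComplexOrder NNReal ENNReal Matrix MatrixOrder Matrix.Norms.L2Operator CStarAlgebra

noncomputable section

/-- The operators on a `d`-dimensional complex Hilbert space, as `d × d` complex matrices. They
carry the operator norm for the Euclidean norm on `ℂ^d` and the Loewner order, in which `0 ≤ A`
means that `A` is positive semidefinite. -/
abbrev Op (d : ℕ) : Type := Matrix (Fin d) (Fin d) ℂ

/-! ### States and entropies -/

/-- A density operator: a positive operator of unit trace. -/
structure DensityOp (d : ℕ) where
  /-- the underlying matrix -/
  mat : Op d
  posSemidef : mat.PosSemidef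
  trace_eq_one : mat.trace = 1

/-- The eigenvalues of a density operator, repeated according to multiplicity. -/
def DensityOp.eigenvalues {d : ℕ} (ρ : DensityOp d) : Fin d → ℝ :=
  ρ.posSemidef.isHermitian.eigenvalues

/-- The von Neumann entropy `-∑ pₖ ln pₖ`, where `0 ln 0 = 0`. -/
def vonNeumannEntropy {d : ℕ} (ρ : DensityOp d) : ℝ :=
  -∑ k, ρ.eigenvalues k * Real.log (ρ.eigenvalues k)

/-- The Tsallis entropy of order `q`; at `q = 1` it is the von Neumann entropy. -/
def tsallisEntropy {d : ℕ} (q : ℝ) (ρ : DensityOp d) : ℝ :=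
  if q = 1 then vonNeumannEntropy ρ
  else 1 / (1 - q) * (∑ k, ρ.eigenvalues k ^ q - 1)

/-- The Rényi entropy of order `q`; at `q = 1` it is the von Neumann entropy. -/
def renyiEntropy {d : ℕ} (q : ℝ) (ρ : DensityOp d) : ℝ :=
  if q = 1 then vonNeumannEntropy ρ
  else 1 / (1 - q) * Real.log (∑ k, ρ.eigenvalues k ^ q)

/-- The Schatten norm `(tr |A| ^ p) ^ (1 / p)` for `p < ∞`, and the operator norm for `p = ∞`. -/
def schattenNorm {d : ℕ} (p : ℝ≥0∞) (A : Op d) : ℝ :=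
  if p = ∞ then ‖A‖
  else (Matrix.trace (CFC.abs A ^ p.toReal)).re ^ (1 / p.toReal)

/-- The labels of the quantum entropies under consideration: Tsallis and Rényi entropies of
order `q > 0`, and the entropies `1 - ‖ρ‖_p` with `1 < p ≤ ∞`. -/
inductive EntropyLabel : Type where
  | tsallis (q : ℝ) (hq : 0 < q) : EntropyLabel
  | renyi (q : ℝ) (hq : 0 < q) : EntropyLabel
  | schatten (p : ℝ≥0∞) (hp : 1 < p) : EntropyLabel

/-- The quantum entropy with a given label. -/
def EntropyLabel.entropy {d : ℕ} : EntropyLabel → DensityOp d → ℝ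
  | .tsallis q _, ρ => tsallisEntropy q ρ
  | .renyi q _, ρ => renyiEntropy q ρ
  | .schatten p _, ρ => 1 - schattenNorm p ρ.mat

/-! ### Quantum dynamical semigroups -/

/-- A quantum dynamical semigroup: a semigroup of completely positive, trace-preserving linear
maps, strongly right continuous at `0`. -/
structure QuantumDynamicalSemigroup (d : ℕ) where
  /-- the map at time `t` -/
  map : ℝ≥0 → (Op d →CP Op d)
  map_add : ∀ (t s : ℝ≥0) (A : Op d), map (t + s) A = map t (map s A)
  map_zero : ∀ A : Op d, map 0 A = A
  tendsto_zero : ∀ A : Op d, Tendsto (fun t => map t A) (𝓝[>] 0) (𝓝 A)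
  trace_map : ∀ (t : ℝ≥0) (A : Op d), (map t A).trace = A.trace

namespace QuantumDynamicalSemigroup

/-- The action of the semigroup on density operators. -/
def evolve {d : ℕ} (Φ : QuantumDynamicalSemigroup d) (t : ℝ≥0) (ρ : DensityOp d) :
    DensityOp d where
  mat := Φ.map t ρ.mat
  posSemidef := Matrix.nonneg_iff_posSemidef.mp
    (map_nonneg (Φ.map t) (Matrix.nonneg_iff_posSemidef.mpr ρ.posSemidef))
  trace_eq_one := (Φ.trace_map t ρ.mat).trans ρ.trace_eq_one

/-- The semigroup does not decrease the entropy `S`. -/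
def DoesNotDecrease {d : ℕ} (Φ : QuantumDynamicalSemigroup d) (S : DensityOp d → ℝ) : Prop :=
  ∀ (ρ : DensityOp d) (t s : ℝ≥0), S (Φ.evolve t ρ) ≤ S (Φ.evolve (t + s) ρ)

/-- `L` is the infinitesimal generator of the semigroup: for every `A`, the limit of
`t⁻¹ (Φ_t A - A)` as `t ↓ 0` exists and equals `L A`. -/
def HasGenerator {d : ℕ} (Φ : QuantumDynamicalSemigroup d) (L : Op d → Op d) : Prop :=
  ∀ A : Op d, Tendsto (fun t : ℝ≥0 => (t : ℝ)⁻¹ • (Φ.map t A - A)) (𝓝[>] 0) (𝓝 (L A))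

end QuantumDynamicalSemigroup

/-- The map
`A ↦ -i [H, A] + ∑ₖ γₖ (Fₖ A Fₖ* - (Fₖ* Fₖ A + A Fₖ* Fₖ) / 2)`, with `d² - 1` summands. -/
def diagonalGenerator {d : ℕ} (H : Op d) (γ : Fin (d ^ 2 - 1) → ℝ) (F : Fin (d ^ 2 - 1) → Op d)
    (A : Op d) : Op d :=
  -Complex.I • (H * A - A * H) +
    ∑ k, (γ k : ℂ) •
      (F k * A * (F k)ᴴ - (1 / 2 : ℂ) • ((F k)ᴴ * F k * A + A * ((F k)ᴴ * F k)))

end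

/-! ### Spectra of density operators -/

/-! Both conditions amount to unitality: every `Φ.map t` fixes `1`. A positive, unital,
trace-preserving map acts on spectra by a doubly stochastic matrix, so Jensen's inequality shows
that it lowers no entropy (`entropy_le_of_unital`). Conversely, the maximally mixed state is the
only maximizer of each entropy (`eq_maximallyMixed`), so a semigroup that does not decrease the
entropy fixes it. In infinitesimal form unitality reads `L 1 = 0`, and for a diagonal generator `L
1` is the difference of the two sums in the balance condition.

There remains the existence of the diagonal form (`exists_diagonalGenerator`). The Choi matrix of
the generator is the limit of `t⁻¹ (choi Φ_t - |ω⟩⟨ω|)`, with `ω` the vectorized identity, hence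
Hermitian and nonnegative on `ω^⊥`, the traceless operators. Diagonalizing its compression to `ω^⊥`
yields the `γ` and `F`; the rest is `V A + A V*`. Trace preservation determines the Hermitian part
of `V`, and the anti-Hermitian part becomes the Hamiltonian. -/

theorem Matrix.IsHermitian.eq_conj_diagonal {d : ℕ} {A : Op d} (hA : A.IsHermitian) :
    A = (hA.eigenvectorUnitary : Op d) * Matrix.diagonal (fun i => (hA.eigenvalues i : ℂ)) *
      star (hA.eigenvectorUnitary : Op d) := by
  conv_lhs => rw [hA.spectral_theorem, Unitary.conjStarAlgAut_apply]
  rfl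

theorem Matrix.IsHermitian.trace_cfc {d : ℕ} {A : Op d} (hA : A.IsHermitian) (f : ℝ → ℝ) :
    (cfc f A).trace = ∑ k, (f (hA.eigenvalues k) : ℂ) := by
  rw [hA.cfc_eq, Matrix.IsHermitian.cfc, Unitary.conjStarAlgAut_apply, Matrix.trace_mul_cycle]
  simp [Matrix.trace]

namespace DensityOp

variable {d : ℕ}

theorem eigenvalues_nonneg (ρ : DensityOp d) (k : Fin d) : 0 ≤ ρ.eigenvalues k :=
  ρ.posSemidef.eigenvalues_nonneg k

theorem sum_eigenvalues (ρ : DensityOp d) : ∑ k, ρ.eigenvalues k = 1 := by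
  have h := ρ.posSemidef.isHermitian.trace_eq_sum_eigenvalues
  rw [ρ.trace_eq_one] at h
  have h2 := congrArg Complex.re h
  simpa [eigenvalues] using h2.symm

theorem exists_eigenvalues_pos (ρ : DensityOp d) : ∃ k, 0 < ρ.eigenvalues k := by
  by_contra! h
  have := ρ.sum_eigenvalues
  have h2 : ∑ k, ρ.eigenvalues k ≤ 0 := Finset.sum_nonpos fun k _ => h k
  linarith

theorem sum_rpow_eigenvalues_pos (ρ : DensityOp d) (q : ℝ) :
    0 < ∑ k, ρ.eigenvalues k ^ q := by
  obtain ⟨k, hk⟩ := ρ.exists_eigenvalues_pos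
  exact Finset.sum_pos' (fun i _ => Real.rpow_nonneg (ρ.eigenvalues_nonneg i) q)
    ⟨k, Finset.mem_univ k, Real.rpow_pos_of_pos hk q⟩

theorem eq_of_mat_eq {ρ ρ' : DensityOp d} (h : ρ.mat = ρ'.mat) : ρ = ρ' := by
  cases ρ; cases ρ'; simp_all

/-- The maximally mixed state. -/
noncomputable def maximallyMixed (d : ℕ) (hd : d ≠ 0) : DensityOp d where
  mat := (d : ℂ)⁻¹ • (1 : Op d)
  posSemidef := Matrix.PosSemidef.one.smul (by positivity)
  trace_eq_one := by
    have : (d : ℂ) ≠ 0 := Nat.cast_ne_zero.mpr hd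
    simp [this]

theorem mat_eq_of_eigenvalues_eq (ρ : DensityOp d) {c : ℝ} (h : ∀ k, ρ.eigenvalues k = c) :
    ρ.mat = (c : ℂ) • (1 : Op d) := by
  rw [ρ.posSemidef.isHermitian.eq_conj_diagonal]
  have : (fun i => ((ρ.posSemidef.isHermitian.eigenvalues i : ℝ) : ℂ)) = fun _ => (c : ℂ) := by
    funext i
    exact congrArg _ (h i)
  rw [this, ← Matrix.smul_one_eq_diagonal]
  simp

theorem eigenvalues_maximallyMixed (hd : d ≠ 0) (k : Fin d) :
    (maximallyMixed d hd).eigenvalues k = (d : ℝ)⁻¹ := by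
  have hA := (maximallyMixed d hd).posSemidef.isHermitian
  have h := hA.eigenvalues_mem_spectrum_real k
  have hne : Nonempty (Fin d) := ⟨k⟩
  have h1 : (maximallyMixed d hd).mat = algebraMap ℝ (Op d) (d : ℝ)⁻¹ := by
    rw [Algebra.algebraMap_eq_smul_one]
    ext i j
    simp [maximallyMixed, Matrix.one_apply]
  have h2 : spectrum ℝ (maximallyMixed d hd).mat = {(d : ℝ)⁻¹} := by
    rw [h1, spectrum.scalar_eq]
  rw [h2] at h
  exact h

/-- A positive unital trace-preserving map acts on spectra by a doubly stochastic matrix. -/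
theorem exists_doublyStochastic (Ψ : Op d →ₗ[ℂ] Op d)
    (hpos : ∀ A : Op d, A.PosSemidef → (Ψ A).PosSemidef) (htr : ∀ A, (Ψ A).trace = A.trace)
    (hone : Ψ 1 = 1) (ρ ρ' : DensityOp d) (h : ρ'.mat = Ψ ρ.mat) :
    ∃ D : Fin d → Fin d → ℝ, (∀ i j, 0 ≤ D i j) ∧ (∀ i, ∑ j, D i j = 1) ∧
      (∀ j, ∑ i, D i j = 1) ∧ ∀ i, ρ'.eigenvalues i = ∑ j, D i j * ρ.eigenvalues j := by
  set U : Op d := (ρ.posSemidef.isHermitian.eigenvectorUnitary : Op d) with hU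
  set V : Op d := (ρ'.posSemidef.isHermitian.eigenvectorUnitary : Op d) with hV
  have hU1 : star U * U = 1 := by simp [hU]
  have hU2 : U * star U = 1 := by simp [hU]
  have hV1 : star V * V = 1 := by simp [hV]
  have hV2 : V * star V = 1 := by simp [hV]
  -- `Ψ` written in the eigenbases of `ρ` and `ρ'`, so that it carries one diagonal matrix of
  -- eigenvalues to the other.
  let T : Op d →ₗ[ℂ] Op d :=
    { toFun := fun X => star V * Ψ (U * X * star U) * V
      map_add' := fun X Y => by simp [mul_add, add_mul]
      map_smul' := fun c X => by simp }
  have hTapp (X : Op d) : T X = star V * Ψ (U * X * star U) * V := rfl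
  have hTtr (X : Op d) : (T X).trace = X.trace := by
    rw [hTapp, Matrix.trace_mul_comm, ← mul_assoc, hV2, one_mul, htr, Matrix.trace_mul_comm,
      ← mul_assoc, hU1, one_mul]
  have hTone : T 1 = 1 := by rw [hTapp, mul_one, hU2, hone, mul_one, hV1]
  have hTpos (X : Op d) (hX : X.PosSemidef) : (T X).PosSemidef :=
    (hpos _ (hX.mul_mul_conjTranspose_same U)).conjTranspose_mul_mul_same V
  let E (j : Fin d) : Op d := Matrix.diagonal (Pi.single j 1)
  have hE (j : Fin d) : (E j).PosSemidef := by
    refine Matrix.PosSemidef.diagonal fun i => ?_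
    by_cases hij : i = j
    · subst hij; simp
    · simp [hij]
  have hdiag (w : Fin d → ℂ) : (Matrix.diagonal w : Op d) = ∑ j, w j • E j := by
    ext a b
    by_cases hab : a = b
    · subst hab; simp [E, Matrix.sum_apply, Pi.single_apply]
    · simp [E, Matrix.sum_apply, hab]
  have hTρ : T (Matrix.diagonal fun j => (ρ.eigenvalues j : ℂ)) =
      Matrix.diagonal fun j => (ρ'.eigenvalues j : ℂ) := by
    have e1 := ρ.posSemidef.isHermitian.eq_conj_diagonal
    have e2 := ρ'.posSemidef.isHermitian.eq_conj_diagonal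
    rw [hTapp]
    change star V * Ψ (U * (Matrix.diagonal fun j =>
      (ρ.posSemidef.isHermitian.eigenvalues j : ℂ)) * star U) * V = _
    rw [← e1, ← h, e2]
    change star V * (V * _ * star V) * V = _
    simp only [mul_assoc, hV1, mul_one]
    rw [← mul_assoc, hV1, one_mul]
    rfl
  -- Row sums are one because `T` is unital, column sums because `T` preserves the trace.
  refine ⟨fun i j => (T (E j) i i).re, fun i j => ?_, fun i => ?_, fun j => ?_, fun i => ?_⟩
  · have := (hTpos _ (hE j)).diag_nonneg (i := i)
    exact (Complex.nonneg_iff.mp this).1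
  · have h1 : T 1 = ∑ j, T (E j) := by
      rw [← map_sum, ← Matrix.diagonal_one, hdiag]
      simp
    rw [hTone] at h1
    rw [← Complex.re_sum, ← Matrix.sum_apply, ← h1]
    simp
  · have h1 := hTtr (E j)
    rw [← Complex.re_sum]
    change (T (E j)).trace.re = 1
    rw [h1]
    simp [E]
  · rw [hdiag, map_sum] at hTρ
    have h1 := congrArg (fun M : Op d => (M i i).re) hTρ
    simp only [map_smul, Matrix.sum_apply, Matrix.smul_apply, smul_eq_mul, Complex.re_sum,
      Complex.re_ofReal_mul, Matrix.diagonal_apply_eq, Complex.ofReal_re] at h1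
    rw [← h1]
    exact Finset.sum_congr rfl fun j _ => mul_comm _ _

/-- Jensen is applied along each row of the doubly stochastic matrix; the column sums then collapse
the double sum. -/
theorem sum_eigenvalues_le_of_concaveOn {f : ℝ → ℝ} (hf : ConcaveOn ℝ (Set.Ici 0) f)
    (Ψ : Op d →ₗ[ℂ] Op d)
    (hpos : ∀ A : Op d, A.PosSemidef → (Ψ A).PosSemidef) (htr : ∀ A, (Ψ A).trace = A.trace)
    (hone : Ψ 1 = 1) (ρ ρ' : DensityOp d) (h : ρ'.mat = Ψ ρ.mat) :
    ∑ k, f (ρ.eigenvalues k) ≤ ∑ k, f (ρ'.eigenvalues k) := by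
  obtain ⟨D, hD, hrow, hcol, hDe⟩ := exists_doublyStochastic Ψ hpos htr hone ρ ρ' h
  calc ∑ k, f (ρ.eigenvalues k) = ∑ k, ∑ i, D i k * f (ρ.eigenvalues k) := by
        refine Finset.sum_congr rfl fun k _ => ?_
        rw [← Finset.sum_mul, hcol, one_mul]
    _ = ∑ i, ∑ k, D i k * f (ρ.eigenvalues k) := Finset.sum_comm
    _ ≤ ∑ i, f (ρ'.eigenvalues i) := by
        refine Finset.sum_le_sum fun i _ => ?_
        have := hf.le_map_sum (t := Finset.univ) (w := D i) (p := ρ.eigenvalues)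
          (fun j _ => hD i j) (hrow i) (fun j _ => ρ.eigenvalues_nonneg j)
        simp only [smul_eq_mul] at this
        rwa [← hDe i] at this

/-- The hypothesis is the reverse of Jensen's inequality with uniform weights; the equality case
makes all eigenvalues equal to their mean `1/d`. -/
theorem eq_maximallyMixed_of_strictConcaveOn (hd : d ≠ 0) {f : ℝ → ℝ}
    (hf : StrictConcaveOn ℝ (Set.Ici 0) f) (ρ : DensityOp d)
    (h : ∑ k, f ((maximallyMixed d hd).eigenvalues k) ≤ ∑ k, f (ρ.eigenvalues k)) :
    ρ = maximallyMixed d hd := by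
  have hd' : (0 : ℝ) < d := by positivity
  have hsum : ∑ _k : Fin d, (d : ℝ)⁻¹ = 1 := by simp [hd'.ne']
  have havg : ∑ k, (d : ℝ)⁻¹ • ρ.eigenvalues k = (d : ℝ)⁻¹ := by
    simp [← Finset.mul_sum, ρ.sum_eigenvalues]
  have hle : f (∑ k, (d : ℝ)⁻¹ • ρ.eigenvalues k) ≤ ∑ k, (d : ℝ)⁻¹ • f (ρ.eigenvalues k) := by
    rw [havg, ← Finset.smul_sum, smul_eq_mul]
    simp only [eigenvalues_maximallyMixed, Finset.sum_const, Finset.card_univ, Fintype.card_fin,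
      nsmul_eq_mul] at h
    calc f (d : ℝ)⁻¹ = (d : ℝ)⁻¹ * (d * f (d : ℝ)⁻¹) := by field_simp
      _ ≤ _ := by gcongr
  have heq := hf.concaveOn.le_map_sum (t := Finset.univ) (w := fun _ => (d : ℝ)⁻¹)
    (p := ρ.eigenvalues) (fun _ _ => by positivity) hsum (fun j _ => ρ.eigenvalues_nonneg j)
  have hconst := (hf.map_sum_eq_iff (t := Finset.univ) (w := fun _ => (d : ℝ)⁻¹)
    (p := ρ.eigenvalues) (fun _ _ => by positivity) hsum
    (fun j _ => ρ.eigenvalues_nonneg j)).mp (le_antisymm hle heq)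
  apply eq_of_mat_eq
  rw [ρ.mat_eq_of_eigenvalues_eq (c := (d : ℝ)⁻¹) fun k => by
    rw [hconst k (Finset.mem_univ k), havg]]
  simp [maximallyMixed]

theorem schattenNorm_eq (ρ : DensityOp d) {p : ℝ≥0∞} (hp : p ≠ ∞) :
    schattenNorm p ρ.mat = (∑ k, ρ.eigenvalues k ^ p.toReal) ^ (1 / p.toReal) := by
  have hnn : (0 : Op d) ≤ ρ.mat := Matrix.nonneg_iff_posSemidef.mpr ρ.posSemidef
  rw [schattenNorm, if_neg hp, CFC.abs_of_nonneg _ hnn, CFC.rpow_eq_cfc_real,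
    ρ.posSemidef.isHermitian.trace_cfc]
  rw [← Complex.ofReal_sum, Complex.ofReal_re]
  rfl

end DensityOp

/-! ### Monotonicity and unique maximizer for every entropy. -/

/-- Apart from the operator-norm entropy, every entropy is an increasing function of the trace of
a strictly concave function of the state. -/
theorem EntropyLabel.exists_strictConcaveOn {d : ℕ} (e : EntropyLabel)
    (he : ∀ hp, e ≠ .schatten ∞ hp) :
    ∃ f : ℝ → ℝ, StrictConcaveOn ℝ (Set.Ici 0) f ∧ ∀ ρ ρ' : DensityOp d,
      e.entropy ρ ≤ e.entropy ρ' ↔ ∑ k, f (ρ.eigenvalues k) ≤ ∑ k, f (ρ'.eigenvalues k) := by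
  have hvN (ρ : DensityOp d) :
      vonNeumannEntropy ρ = ∑ k, Real.negMulLog (ρ.eigenvalues k) := by
    simp [vonNeumannEntropy, Real.negMulLog]
  have hneg (q : ℝ) (hq : 1 < q) : StrictConcaveOn ℝ (Set.Ici 0) fun x : ℝ => -x ^ q :=
    (strictConvexOn_rpow hq).neg
  cases e with
  | tsallis q hq =>
    rcases lt_trichotomy q 1 with h | rfl | h
    · refine ⟨_, Real.strictConcaveOn_rpow hq h, fun ρ ρ' => ?_⟩
      have h1 : 0 < 1 / (1 - q) := by
        have : 0 < 1 - q := by linarith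
        positivity
      simp only [entropy, tsallisEntropy, if_neg h.ne]
      rw [mul_le_mul_iff_right₀ h1, sub_le_sub_iff_right]
    · exact ⟨_, Real.strictConcaveOn_negMulLog, fun ρ ρ' => by
        simp [entropy, tsallisEntropy, hvN]⟩
    -- For `q > 1` the prefactor `1 / (1 - q)` is negative, which matches the sign in `-x ^ q`.
    · refine ⟨_, hneg q h, fun ρ ρ' => ?_⟩
      have h1 : 1 / (1 - q) < 0 := one_div_neg.mpr (by linarith)
      simp only [entropy, tsallisEntropy, if_neg h.ne', Finset.sum_neg_distrib]
      rw [mul_le_mul_left_of_neg h1, sub_le_sub_iff_right, neg_le_neg_iff]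
  | renyi q hq =>
    rcases lt_trichotomy q 1 with h | rfl | h
    · refine ⟨_, Real.strictConcaveOn_rpow hq h, fun ρ ρ' => ?_⟩
      have h1 : 0 < 1 / (1 - q) := by
        have : 0 < 1 - q := by linarith
        positivity
      simp only [entropy, renyiEntropy, if_neg h.ne]
      rw [mul_le_mul_iff_right₀ h1, Real.log_le_log_iff (ρ.sum_rpow_eigenvalues_pos q)
        (ρ'.sum_rpow_eigenvalues_pos q)]
    · exact ⟨_, Real.strictConcaveOn_negMulLog, fun ρ ρ' => by
        simp [entropy, renyiEntropy, hvN]⟩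
    · refine ⟨_, hneg q h, fun ρ ρ' => ?_⟩
      have h1 : 1 / (1 - q) < 0 := one_div_neg.mpr (by linarith)
      simp only [entropy, renyiEntropy, if_neg h.ne', Finset.sum_neg_distrib]
      rw [mul_le_mul_left_of_neg h1, Real.log_le_log_iff (ρ'.sum_rpow_eigenvalues_pos q)
        (ρ.sum_rpow_eigenvalues_pos q), neg_le_neg_iff]
  | schatten p hp =>
    have hpt : p ≠ ∞ := fun h => by subst h; exact he hp rfl
    have hp1 : 1 < p.toReal := by
      rw [← ENNReal.toReal_one]
      exact (ENNReal.toReal_lt_toReal ENNReal.one_ne_top hpt).mpr hp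
    refine ⟨_, hneg _ hp1, fun ρ ρ' => ?_⟩
    simp only [entropy, Finset.sum_neg_distrib]
    rw [sub_le_sub_iff_left, neg_le_neg_iff, ρ.schattenNorm_eq hpt, ρ'.schattenNorm_eq hpt]
    exact Real.rpow_le_rpow_iff (ρ'.sum_rpow_eigenvalues_pos _).le
      (ρ.sum_rpow_eigenvalues_pos _).le (by positivity)

/-- For `p = ∞` strict concavity is not available; the Loewner order replaces it. -/
theorem Matrix.PosSemidef.norm_le_of_le_smul_one {d : ℕ} {A : Op d} (hA : A.PosSemidef) {c : ℝ}
    (hc : 0 ≤ c) (h : A ≤ (c : ℂ) • (1 : Op d)) : ‖A‖ ≤ c := by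
  rw [CStarAlgebra.norm_le_iff_le_algebraMap A hc (Matrix.nonneg_iff_posSemidef.mpr hA)]
  convert h using 1
  rw [Algebra.algebraMap_eq_smul_one]
  ext i j
  simp [Matrix.one_apply]

theorem Matrix.PosSemidef.le_norm_smul_one {d : ℕ} {A : Op d} (hA : A.PosSemidef) :
    A ≤ ((‖A‖ : ℝ) : ℂ) • (1 : Op d) := by
  have := (CStarAlgebra.norm_le_iff_le_algebraMap A (norm_nonneg A)
    (Matrix.nonneg_iff_posSemidef.mpr hA)).mp le_rfl
  convert this using 1
  rw [Algebra.algebraMap_eq_smul_one]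
  ext i j
  simp [Matrix.one_apply]

/-- Positive unital trace-preserving maps do not decrease any of the entropies. -/
theorem EntropyLabel.entropy_le_of_unital {d : ℕ} (e : EntropyLabel) (Ψ : Op d →ₗ[ℂ] Op d)
    (hpos : ∀ A : Op d, A.PosSemidef → (Ψ A).PosSemidef) (htr : ∀ A, (Ψ A).trace = A.trace)
    (hone : Ψ 1 = 1) (ρ ρ' : DensityOp d) (h : ρ'.mat = Ψ ρ.mat) :
    e.entropy ρ ≤ e.entropy ρ' := by
  by_cases he : ∀ hp, e ≠ .schatten ∞ hp
  · obtain ⟨f, hf, hle⟩ := e.exists_strictConcaveOn (d := d) he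
    exact (hle ρ ρ').mpr
      (DensityOp.sum_eigenvalues_le_of_concaveOn hf.concaveOn Ψ hpos htr hone ρ ρ' h)
  · push Not at he
    obtain ⟨hp, rfl⟩ := he
    simp only [entropy, schattenNorm, if_true]
    refine sub_le_sub_left (ρ'.posSemidef.norm_le_of_le_smul_one (norm_nonneg _) ?_) 1
    -- Apply `Ψ` to `‖ρ‖ • 1 - ρ ≥ 0` and use that `Ψ` is unital.
    have h1 := hpos _ (Matrix.le_iff.mp ρ.posSemidef.le_norm_smul_one)
    rw [map_sub, map_smul, hone, ← h] at h1
    exact Matrix.le_iff.mpr h1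

/-- The maximally mixed state is the only state of maximal entropy. -/
theorem EntropyLabel.eq_maximallyMixed {d : ℕ} (hd : d ≠ 0) (e : EntropyLabel) (ρ : DensityOp d)
    (h : e.entropy (DensityOp.maximallyMixed d hd) ≤ e.entropy ρ) :
    ρ = DensityOp.maximallyMixed d hd := by
  by_cases he : ∀ hp, e ≠ .schatten ∞ hp
  · obtain ⟨f, hf, hle⟩ := e.exists_strictConcaveOn (d := d) he
    exact ρ.eq_maximallyMixed_of_strictConcaveOn hd hf ((hle _ _).mp h)
  · push Not at he
    obtain ⟨hp, rfl⟩ := he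
    simp only [entropy, schattenNorm, if_true] at h
    have hd' : (d : ℂ) ≠ 0 := Nat.cast_ne_zero.mpr hd
    have hmm : ‖(DensityOp.maximallyMixed d hd).mat‖ ≤ (d : ℝ)⁻¹ :=
      (DensityOp.maximallyMixed d hd).posSemidef.norm_le_of_le_smul_one (by positivity)
        (by simp [DensityOp.maximallyMixed])
    have hle : ‖ρ.mat‖ ≤ (d : ℝ)⁻¹ := by linarith
    -- A positive matrix of trace zero vanishes.
    have h1 : ((d : ℂ)⁻¹ • (1 : Op d) - ρ.mat).PosSemidef := by
      refine Matrix.le_iff.mp (ρ.posSemidef.le_norm_smul_one.trans ?_)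
      rw [Matrix.le_iff, ← sub_smul]
      refine Matrix.PosSemidef.one.smul ?_
      have : ((d : ℂ)⁻¹ - (‖ρ.mat‖ : ℝ)) = (((d : ℝ)⁻¹ - ‖ρ.mat‖ : ℝ) : ℂ) := by push_cast; rfl
      rw [this]
      exact_mod_cast sub_nonneg.mpr hle
    have h2 : ((d : ℂ)⁻¹ • (1 : Op d) - ρ.mat).trace = 0 := by
      simp [ρ.trace_eq_one, hd']
    have h3 := h1.trace_eq_zero_iff.mp h2
    exact DensityOp.eq_of_mat_eq (sub_eq_zero.mp h3).symm

/-! ### One-parameter semigroups in Banach algebras -/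

section Semigroup

variable {𝔸 : Type*} [NormedRing 𝔸] [CompleteSpace 𝔸] {U : ℝ≥0 → 𝔸}

/-- Right continuity is immediate from the semigroup law. For left continuity, `U (t - s)` is close
to `1`, hence invertible, and `U s = U t * (U (t - s))⁻¹`. -/
theorem continuous_of_semigroup (hadd : ∀ t s, U (t + s) = U t * U s) (hzero : U 0 = 1)
    (hlim : Tendsto U (𝓝[>] 0) (𝓝 1)) : Continuous U := by
  have h0 : Tendsto U (𝓝 0) (𝓝 1) := by
    have h1 : ContinuousAt U 0 := by
      rw [continuousAt_iff_continuous_left'_right']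
      refine ⟨?_, by rw [ContinuousWithinAt, hzero]; exact hlim⟩
      simp [ContinuousWithinAt]
    rwa [ContinuousAt, hzero] at h1
  rw [continuous_iff_continuousAt]
  intro t
  rw [continuousAt_iff_continuous_left_right]
  constructor
  · have hsub : Tendsto (fun s => U (t - s)) (𝓝[≤] t) (𝓝 1) := by
      refine h0.comp (Tendsto.mono_left ?_ nhdsWithin_le_nhds)
      have : Continuous fun s : ℝ≥0 => t - s := by fun_prop
      simpa using this.tendsto t
    have hinv : Tendsto (fun s => U t * Ring.inverse (U (t - s))) (𝓝[≤] t) (𝓝 (U t)) := by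
      have h1 := (NormedRing.inverse_continuousAt (1 : 𝔸ˣ)).tendsto
      simp only [Units.val_one, Ring.inverse_one] at h1
      simpa using (h1.comp hsub).const_mul (U t)
    refine hinv.congr' ?_
    have hunit : ∀ᶠ s in 𝓝[≤] t, IsUnit (U (t - s)) :=
      hsub.eventually ((Units.isOpen (R := 𝔸)).mem_nhds isUnit_one)
    filter_upwards [hunit, self_mem_nhdsWithin] with s hs hst
    have : U t = U s * U (t - s) := by rw [← hadd, add_tsub_cancel_of_le hst]
    rw [this, Ring.mul_inverse_cancel_right _ _ hs]
  · have hsub : Tendsto (fun s => U (s - t)) (𝓝[≥] t) (𝓝 1) := by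
      refine h0.comp (Tendsto.mono_left ?_ nhdsWithin_le_nhds)
      have : Continuous fun s : ℝ≥0 => s - t := by fun_prop
      simpa using this.tendsto t
    have h1 : Tendsto (fun s => U t * U (s - t)) (𝓝[≥] t) (𝓝 (U t)) := by
      simpa using hsub.const_mul (U t)
    refine h1.congr' ?_
    filter_upwards [self_mem_nhdsWithin] with s hst
    rw [← hadd, add_tsub_cancel_of_le hst]

/-- Averaging makes the semigroup differentiable: with `V = ∫₀ʰ U`, the product `(U t - 1) * V` is a
difference of integrals over intervals of length `t`. For small `h` the mean `h⁻¹ V` is near `1`, so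
`V` can be cancelled. -/
theorem exists_generator_of_semigroup [NormedAlgebra ℝ 𝔸] (hadd : ∀ t s, U (t + s) = U t * U s) (hzero : U 0 = 1)
    (hlim : Tendsto U (𝓝[>] 0) (𝓝 1)) :
    ∃ G : 𝔸, Tendsto (fun t : ℝ≥0 => (t : ℝ)⁻¹ • (U t - 1)) (𝓝[>] 0) (𝓝 G) := by
  set W : ℝ → 𝔸 := fun x => U x.toNNReal with hW
  have hWc : Continuous W :=
    (continuous_of_semigroup hadd hzero hlim).comp continuous_real_toNNReal
  have hW0 : W 0 = 1 := by simp [hW, hzero]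
  have hint (a b : ℝ) : IntervalIntegrable W MeasureTheory.volume a b := hWc.intervalIntegrable a b
  have hderiv (a b : ℝ) : HasDerivAt (fun u => ∫ x in a..u, W x) (W b) b :=
    intervalIntegral.integral_hasDerivAt_right (hint a b)
      (hWc.stronglyMeasurableAtFilter _ _) hWc.continuousAt
  obtain ⟨h, hh, hunit⟩ : ∃ h : ℝ, 0 < h ∧ IsUnit (∫ x in (0 : ℝ)..h, W x) := by
    have h1 : Tendsto (fun h : ℝ => h⁻¹ • ∫ x in (0 : ℝ)..h, W x) (𝓝[>] 0) (𝓝 1) := by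
      have := (hderiv 0 0).tendsto_slope_zero_right
      simpa [hW0] using this
    obtain ⟨h, hu, hh⟩ := ((h1.eventually ((Units.isOpen (R := 𝔸)).mem_nhds isUnit_one)).and
      self_mem_nhdsWithin).exists
    refine ⟨h, hh, ?_⟩
    have hne : h ≠ 0 := ne_of_gt hh
    have h2 : IsUnit (Units.mk0 h hne • (h⁻¹ • ∫ x in (0 : ℝ)..h, W x)) := by
      rw [isUnit_smul_iff]; exact hu
    rwa [Units.smul_mk0, smul_inv_smul₀ hne] at h2
  set V := ∫ x in (0 : ℝ)..h, W x with hV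
  have hkey (t : ℝ≥0) : (U t - 1) * V = ((∫ x in h..(h + t), W x) - ∫ x in (0 : ℝ)..t, W x) := by
    have h1 : U t * V = ∫ x in (t : ℝ)..(h + t), W x := by
      have h2 : (∫ x in (0 : ℝ)..h, W (x + t)) = ∫ x in (t : ℝ)..(h + t), W x := by
        rw [intervalIntegral.integral_comp_add_right, zero_add]
      rw [← h2, hV, 
        ← ContinuousLinearMap.mul_apply' ℝ 𝔸, ← ContinuousLinearMap.intervalIntegral_comp_comm _ (hint 0 h)]
      refine intervalIntegral.integral_congr fun x hx => ?_
      rw [Set.uIcc_of_le hh.le] at hx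
      simp only [hW, ContinuousLinearMap.mul_apply']
      rw [← hadd, Real.toNNReal_add hx.1 t.coe_nonneg, Real.toNNReal_coe, add_comm]
    rw [sub_mul, one_mul, h1, hV,
      ← intervalIntegral.integral_add_adjacent_intervals (hint 0 t) (hint t h),
      ← intervalIntegral.integral_add_adjacent_intervals (hint t h) (hint h (h + t))]
    abel
  have hlim2 : Tendsto (fun t : ℝ≥0 => (t : ℝ)⁻¹ • ((U t - 1) * V)) (𝓝[>] 0)
      (𝓝 (W h - 1)) := by
    have h1 : HasDerivAt (fun t : ℝ => (∫ x in h..(h + t), W x) - ∫ x in (0 : ℝ)..t, W x)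
        (W h - 1) 0 := by
      have h2 : HasDerivAt (fun t : ℝ => ∫ x in h..(h + t), W x) (W h) 0 := by
        have h3 := hderiv h (h + 0)
        have := h3.comp_const_add h 0
        simpa using this
      have h4 := hderiv 0 0
      rw [hW0] at h4
      exact h2.sub h4
    have h5 := h1.tendsto_slope_zero_right
    have h6 : Tendsto (fun t : ℝ≥0 => (t : ℝ)) (𝓝[>] 0) (𝓝[>] 0) := by
      refine tendsto_nhdsWithin_iff.mpr ⟨?_, ?_⟩
      · exact (NNReal.continuous_coe.tendsto' 0 0 rfl).mono_left nhdsWithin_le_nhds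
      · filter_upwards [self_mem_nhdsWithin] with t ht
        exact NNReal.coe_pos.mpr ht
    refine (h5.comp h6).congr fun t => ?_
    simp [hkey]
  obtain ⟨u, hu⟩ := hunit
  refine ⟨(W h - 1) * ↑u⁻¹, (hlim2.mul_const (↑u⁻¹ : 𝔸)).congr fun t => ?_⟩
  rw [smul_mul_assoc, ← hu, Units.mul_inv_cancel_right]

end Semigroup

/-- In finite dimension an operator depends linearly, hence continuously, on its values on a basis.
This upgrades strong continuity to norm continuity. -/
theorem tendsto_toContinuousLinearMap {ι E F : Type*} [NormedAddCommGroup E] [NormedSpace ℂ E]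
    [FiniteDimensional ℂ E] [NormedAddCommGroup F] [NormedSpace ℂ F] [FiniteDimensional ℂ F]
    {l : Filter ι} {T : ι → E →L[ℂ] F} {T' : E →L[ℂ] F}
    (h : ∀ x, Tendsto (fun i => T i x) l (𝓝 (T' x))) : Tendsto T l (𝓝 T') := by
  let b := Module.finBasis ℂ E
  let L : (Fin (Module.finrank ℂ E) → F) →ₗ[ℂ] (E →L[ℂ] F) :=
    (LinearMap.toContinuousLinearMap (𝕜 := ℂ) (E := E) (F' := F)).toLinearMap ∘ₗ
      (b.constr ℂ).toLinearMap
  have hL (S : E →L[ℂ] F) : L (fun i => S (b i)) = S := by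
    ext x
    change b.constr ℂ (fun i => (S : E →ₗ[ℂ] F) (b i)) x = S x
    rw [b.constr_self]
    rfl
  have hLc : Continuous L := L.continuous_of_finiteDimensional
  have h1 : Tendsto (fun i => L fun k => T i (b k)) l (𝓝 (L fun k => T' (b k))) :=
    (hLc.tendsto _).comp (tendsto_pi_nhds.mpr fun k => h (b k))
  simpa only [hL] using h1

/-! ### Generators, and entropy growth as unitality. -/

namespace QuantumDynamicalSemigroup

variable {d : ℕ} (Φ : QuantumDynamicalSemigroup d)

/-- The maps of the semigroup, as continuous linear maps. -/
noncomputable def toCLM (t : ℝ≥0) : Op d →L[ℂ] Op d :=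
  LinearMap.toContinuousLinearMap (Φ.map t).toLinearMap

theorem toCLM_apply (t : ℝ≥0) (A : Op d) : Φ.toCLM t A = Φ.map t A := rfl

theorem toCLM_add (t s : ℝ≥0) : Φ.toCLM (t + s) = Φ.toCLM t * Φ.toCLM s := by
  ext1 A
  exact Φ.map_add t s A

theorem toCLM_zero : Φ.toCLM 0 = 1 := by
  ext1 A
  exact Φ.map_zero A

theorem tendsto_toCLM : Tendsto Φ.toCLM (𝓝[>] 0) (𝓝 1) :=
  tendsto_toContinuousLinearMap fun A => Φ.tendsto_zero A

theorem exists_hasGenerator : ∃ G : Op d →L[ℂ] Op d, Φ.HasGenerator G := by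
  obtain ⟨G, hG⟩ := exists_generator_of_semigroup (𝔸 := Op d →L[ℂ] Op d) Φ.toCLM_add Φ.toCLM_zero Φ.tendsto_toCLM
  refine ⟨G, fun A => ?_⟩
  exact ((ContinuousLinearMap.apply ℂ (Op d) A).continuous.tendsto G).comp hG

theorem continuous_map_apply (A : Op d) : Continuous fun t => Φ.map t A :=
  (ContinuousLinearMap.apply ℂ (Op d) A).continuous.comp
    (continuous_of_semigroup (𝔸 := Op d →L[ℂ] Op d) Φ.toCLM_add Φ.toCLM_zero Φ.tendsto_toCLM)

/-- The right derivative of `Φ_x A` is `Φ_x (L A) = 0`, and a continuous function with zero right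
derivative is constant. -/
theorem map_eq_of_generator_eq_zero {L : Op d → Op d} (hL : Φ.HasGenerator L) {A : Op d}
    (hA : L A = 0) (t : ℝ≥0) : Φ.map t A = A := by
  set f : ℝ → Op d := fun x => Φ.map x.toNNReal A with hf
  have hfc : Continuous f := (Φ.continuous_map_apply A).comp continuous_real_toNNReal
  have hd (x : ℝ) (hx : x ∈ Set.Ico (0 : ℝ) t) : HasDerivWithinAt f 0 (Set.Ici x) x := by
    rw [← hasDerivWithinAt_Ioi_iff_Ici, hasDerivWithinAt_iff_tendsto_slope' Set.self_notMem_Ioi]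
    have h1 : Tendsto (fun y : ℝ => (y - x).toNNReal) (𝓝[>] x) (𝓝[>] 0) := by
      refine tendsto_nhdsWithin_iff.mpr ⟨?_, ?_⟩
      · have : Continuous fun y : ℝ => (y - x).toNNReal := by fun_prop
        exact (this.tendsto' x 0 (by simp)).mono_left nhdsWithin_le_nhds
      · filter_upwards [self_mem_nhdsWithin] with y hy
        exact Real.toNNReal_pos.mpr (sub_pos.mpr hy)
    have h2 := ((Φ.toCLM x.toNNReal).continuous.tendsto _).comp ((hL A).comp h1)
    rw [hA, ContinuousLinearMap.map_zero] at h2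
    refine h2.congr' ?_
    filter_upwards [self_mem_nhdsWithin] with y hy
    have hxy : 0 ≤ y - x := (sub_pos.mpr hy).le
    have hy2 : y.toNNReal = x.toNNReal + (y - x).toNNReal := by
      rw [← Real.toNNReal_add hx.1 hxy]; congr 1; ring
    simp only [Function.comp_apply, slope, vsub_eq_sub, hf]
    rw [hy2, Φ.map_add, ContinuousLinearMap.map_smul_of_tower, map_sub, Φ.toCLM_apply,
      Φ.toCLM_apply, Real.coe_toNNReal _ hxy]
  have h := constant_of_has_deriv_right_zero hfc.continuousOn hd (t : ℝ) ⟨t.2, le_rfl⟩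
  simpa [hf, Φ.map_zero] using h

theorem map_posSemidef (t : ℝ≥0) {A : Op d} (hA : A.PosSemidef) : (Φ.map t A).PosSemidef :=
  Matrix.nonneg_iff_posSemidef.mp
    (map_nonneg (Φ.map t) (Matrix.nonneg_iff_posSemidef.mpr hA))

theorem doesNotDecrease_of_map_one (h : ∀ t, Φ.map t 1 = 1) (e : EntropyLabel) :
    Φ.DoesNotDecrease e.entropy := fun ρ t s =>
  e.entropy_le_of_unital (Φ.map s).toLinearMap (fun _ hA => Φ.map_posSemidef s hA)
    (fun A => Φ.trace_map s A) (h s) _ _ (by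
      change Φ.map (t + s) ρ.mat = Φ.map s (Φ.map t ρ.mat)
      rw [add_comm, Φ.map_add])

theorem map_one_of_doesNotDecrease (hd : d ≠ 0) {e : EntropyLabel}
    (h : Φ.DoesNotDecrease e.entropy) (t : ℝ≥0) : Φ.map t 1 = 1 := by
  have h1 := h (DensityOp.maximallyMixed d hd) 0 t
  have h2 : Φ.evolve 0 (DensityOp.maximallyMixed d hd) = DensityOp.maximallyMixed d hd :=
    DensityOp.eq_of_mat_eq (Φ.map_zero _)
  rw [h2, zero_add] at h1
  have h3 := congrArg DensityOp.mat (e.eq_maximallyMixed hd _ h1)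
  change Φ.map t ((d : ℂ)⁻¹ • (1 : Op d)) = (d : ℂ)⁻¹ • (1 : Op d) at h3
  rw [map_smul] at h3
  exact smul_right_injective _ (inv_ne_zero (Nat.cast_ne_zero.mpr hd)) h3

end QuantumDynamicalSemigroup

/-! ### The generator of a quantum dynamical semigroup -/

/-- A symmetric operator that is nonnegative on the orthogonal complement of `ω` is, up to terms
in `ω`, a nonnegative combination of projections along an orthonormal basis of that complement. -/
theorem LinearMap.IsSymmetric.exists_orthonormal_decomposition {E : Type*}
    [NormedAddCommGroup E] [InnerProductSpace ℂ E] {n : ℕ} (hn : Module.finrank ℂ E = n + 1)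
    {S : E →ₗ[ℂ] E} (hS : S.IsSymmetric) {ω : E} (hω : ω ≠ 0)
    (hpos : ∀ w, inner ℂ ω w = 0 → 0 ≤ (inner ℂ w (S w)).re) :
    ∃ (γ : Fin n → ℝ) (b : Fin n → E) (v : E), (∀ k, 0 ≤ γ k) ∧ Orthonormal ℂ b ∧
      (∀ k, inner ℂ ω (b k) = 0) ∧
      ∀ y, S y = ∑ k, ((γ k : ℂ) * inner ℂ (b k) y) • b k + inner ℂ ω y • v +
        inner ℂ v y • ω := by
  have : Fact (Module.finrank ℂ E = n + 1) := ⟨hn⟩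
  have : FiniteDimensional ℂ E := .of_fact_finrank_eq_succ n
  set W : Submodule ℂ E := (ℂ ∙ ω)ᗮ with hW
  have hWn : Module.finrank ℂ W = n := Submodule.finrank_orthogonal_span_singleton hω
  have hmem (w : E) : w ∈ W ↔ inner ℂ ω w = 0 := Submodule.mem_orthogonal_singleton_iff_inner_right
  let T : W →ₗ[ℂ] W := W.orthogonalProjectionOnto.toLinearMap ∘ₗ S ∘ₗ W.subtype
  have hTapp (w : W) : T w = W.orthogonalProjectionOnto (S w) := rfl
  have hT : T.IsSymmetric := fun x y => by
    rw [hTapp, hTapp, Submodule.inner_orthogonalProjectionOnto_eq_of_mem_right,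
      Submodule.inner_orthogonalProjectionOnto_eq_of_mem_left]
    exact hS x y
  set β := hT.eigenvectorBasis hWn with hβ
  set γ := hT.eigenvalues hWn with hγ
  have hTβ (k : Fin n) : T (β k) = (γ k : ℂ) • β k := hT.apply_eigenvectorBasis hWn k
  have hβω (k : Fin n) : inner ℂ ω (β k : E) = 0 := (hmem _).mp (β k).2
  have hγ0 (k : Fin n) : 0 ≤ γ k := by
    have h1 := hpos (β k) (hβω k)
    have h2 : inner ℂ (β k : E) (S (β k)) = (γ k : ℂ) := by
      rw [← Submodule.inner_orthogonalProjectionOnto_eq_of_mem_left, ← hTapp, hTβ,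
        inner_smul_right, inner_self_eq_norm_sq_to_K, β.orthonormal.1 k]
      simp
    rwa [h2, Complex.ofReal_re] at h1
  set N : ℂ := inner ℂ ω ω with hN
  have hN0 : N ≠ 0 := inner_self_ne_zero.mpr hω
  have hNconj : (starRingEnd ℂ) N = N := inner_conj_symm _ _
  have hsconj : (starRingEnd ℂ) (inner ℂ ω (S ω)) = inner ℂ ω (S ω) := by
    rw [inner_conj_symm]; exact hS ω ω
  -- On `ω^⊥`, `S` is its diagonalized compression plus a component along `ω`, which symmetry
  -- expresses through `S ω`.
  have hSW (w : E) (hw : inner ℂ ω w = 0) :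
      S w = ∑ k, ((γ k : ℂ) * inner ℂ (β k : E) w) • (β k : E) + (N⁻¹ * inner ℂ (S ω) w) • ω := by
    have h1 : T ⟨w, (hmem w).mpr hw⟩ = ∑ k, ((γ k : ℂ) * inner ℂ (β k : E) w) • β k := by
      conv_lhs => rw [← β.sum_repr' ⟨w, (hmem w).mpr hw⟩, map_sum]
      refine Finset.sum_congr rfl fun k _ => ?_
      rw [map_smul, hTβ, smul_smul, mul_comm]
      rfl
    have h2 := congrArg (Subtype.val (p := (· ∈ W))) h1
    rw [hTapp] at h2
    have h3 := (ℂ ∙ ω).starProjection_add_starProjection_orthogonal (S w)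
    rw [Submodule.starProjection_singleton, RCLike.ofReal_pow,
      ← inner_self_eq_norm_sq_to_K (𝕜 := ℂ)] at h3
    rw [← h3, add_comm]
    congr 1
    · refine h2.trans ?_
      simp
    · rw [hS ω w, div_eq_inv_mul]
  -- The terms `|Sω⟩⟨ω|/N` and `|ω⟩⟨Sω|/N` count the `|ω⟩⟨ω|` component twice; the subtraction
  -- removes the excess, half from each.
  refine ⟨γ, fun k => β k, N⁻¹ • S ω - (inner ℂ ω (S ω) * (N⁻¹) ^ 2 / 2) • ω, hγ0,
    β.orthonormal.comp_linearIsometry W.subtypeₗᵢ, hβω, fun y => ?_⟩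
  set c : ℂ := N⁻¹ * inner ℂ ω y with hc
  have hcN : inner ℂ ω y = c * N := by rw [hc]; field_simp
  have hyc : inner ℂ ω (y - c • ω) = 0 := by
    rw [inner_sub_right, inner_smul_right, hcN, sub_self]
  have h1 := hSW _ hyc
  have h2 (k : Fin n) : inner ℂ (β k : E) (y - c • ω) = inner ℂ (β k : E) y := by
    rw [inner_sub_right, inner_smul_right, inner_eq_zero_symm.mp (hβω k), mul_zero, sub_zero]
  simp only [h2, map_sub, map_smul, sub_eq_iff_eq_add, inner_sub_right, inner_smul_right,
    hS ω ω] at h1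
  rw [h1, inner_sub_left, inner_smul_left, inner_smul_left, hcN]
  simp only [map_mul, map_pow, map_inv₀, hNconj, hsconj, map_div₀, Complex.conj_ofNat]
  rw [add_assoc, add_assoc]
  congr 1
  match_scalars
  · field_simp
    ring
  · field_simp

/-! ### Choi matrices. -/

namespace Matrix

variable {d : ℕ}

/-- The Choi matrix of a map on matrices. -/
def choi (T : Op d → Op d) : Matrix (Fin d × Fin d) (Fin d × Fin d) ℂ :=
  .of fun p q => T (single p.2 q.2 1) p.1 q.1

/-- Nonnegative elements are generated by the `star B * B`, and flattening the blocks of `B` turns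
each into a Gram matrix `Yᴴ * Y`. -/
theorem posSemidef_of_cstarMatrix_nonneg {N : CStarMatrix (Fin d) (Fin d) (Op d)} (hN : 0 ≤ N) :
    (of fun p q : Fin d × Fin d => N p.2 q.2 p.1 q.1).PosSemidef := by
  rw [StarOrderedRing.nonneg_iff] at hN
  induction hN using AddSubmonoid.closure_induction with
  | mem N hN =>
    obtain ⟨B, rfl⟩ := hN
    let Y : Matrix (Fin d × Fin d) (Fin d × Fin d) ℂ := of fun m p => B m.1 p.2 m.2 p.1
    convert posSemidef_conjTranspose_mul_self Y using 1
    ext p q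
    change (∑ m, star (B m p.2) * B m q.2) p.1 q.1 = _
    simp only [sum_apply, mul_apply, star_apply, Fintype.sum_prod_type, conjTranspose_apply, Y,
      of_apply]
  | zero => exact PosSemidef.zero
  | add M N _ _ hM hN => exact hM.add hN

theorem posSemidef_choi (T : Op d →CP Op d) : (choi T).PosSemidef := by
  -- The block matrix of matrix units is positive, since `star R * R` is `d` times it.
  let R : CStarMatrix (Fin d) (Fin d) (Op d) := CStarMatrix.ofMatrix fun a j => single a j 1
  have hRapp (i j : Fin d) : (star R * R) i j = (d : ℂ) • single i j 1 := by
    change ∑ a, (star (single a i 1 : Op d) * (single a j 1 : Op d) : Op d) = _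
    simp [star_eq_conjTranspose]
  have h := posSemidef_of_cstarMatrix_nonneg
    (T.map_cstarMatrix_nonneg _ (star_mul_self_nonneg R))
  have h2 : (of fun p q : Fin d × Fin d => ((star R * R).map T) p.2 q.2 p.1 q.1) =
      (d : ℂ) • choi T := by
    ext p q
    rw [of_apply, CStarMatrix.map_apply, hRapp, map_smul]
    rfl
  rw [h2] at h
  rcases Nat.eq_zero_or_pos d with rfl | hd
  · convert PosSemidef.zero
    ext p
    exact p.1.elim0
  · have hd' : (d : ℂ) ≠ 0 := Nat.cast_ne_zero.mpr hd.ne'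
    have h3 := h.smul (a := (d : ℂ)⁻¹) (by positivity)
    rwa [smul_smul, inv_mul_cancel₀ hd', one_smul] at h3

theorem mul_single_one_apply (M : Op d) (i j k l : Fin d) :
    (M * single i j (1 : ℂ)) k l = M k i * (1 : Op d) l j := by
  by_cases h : l = j
  · subst h; simp
  · simp [h]

theorem single_one_mul_apply (M : Op d) (i j k l : Fin d) :
    (single i j (1 : ℂ) * M) k l = (1 : Op d) k i * M j l := by
  by_cases h : k = i
  · subst h; simp
  · simp [h]

/-- A map whose Choi matrix is given by `∑ γₘ |fₘ⟩⟨fₘ| + |v⟩⟨ω| + |ω⟩⟨v|`, where `ω` is the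
vectorized identity, in operator form. -/
theorem eq_of_choi_eq {ι : Type*} [Fintype ι] (G : Op d →ₗ[ℂ] Op d) (γ : ι → ℝ) (F : ι → Op d)
    (V : Op d)
    (h : ∀ p q, choi G p q = ∑ m, (γ m : ℂ) * F m p.1 p.2 * star (F m q.1 q.2) +
      V p.1 p.2 * (1 : Op d) q.1 q.2 + (1 : Op d) p.1 p.2 * star (V q.1 q.2)) (A : Op d) :
    G A = ∑ m, (γ m : ℂ) • (F m * A * (F m)ᴴ) + V * A + A * Vᴴ := by
  let R : Op d →ₗ[ℂ] Op d :=
    { toFun := fun A => ∑ m, (γ m : ℂ) • (F m * A * (F m)ᴴ) + V * A + A * Vᴴ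
      map_add' := fun A B => by
        simp only [mul_add, add_mul, smul_add, Finset.sum_add_distrib]; abel
      map_smul' := fun c A => by
        simp only [mul_smul_comm, smul_mul_assoc, smul_add, Finset.smul_sum, RingHom.id_apply,
          smul_comm c] }
  suffices hGR : G = R from congrArg (fun T : Op d →ₗ[ℂ] Op d => T A) hGR
  refine ext_linearMap ℂ fun i j => LinearMap.ext_ring ?_
  ext k l
  have h1 := h (k, i) (l, j)
  change G (single i j 1) k l = _ at h1
  change G (single i j 1) k l = (∑ m, (γ m : ℂ) • (F m * single i j (1 : ℂ) * (F m)ᴴ) +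
    V * single i j (1 : ℂ) + single i j (1 : ℂ) * Vᴴ : Op d) k l
  rw [h1]
  simp only [add_apply, sum_apply, smul_apply, smul_eq_mul, mul_single_one_apply,
    single_one_mul_apply, conjTranspose_apply]
  congr 2
  refine Finset.sum_congr rfl fun m _ => ?_
  rw [mul_assoc, mul_apply]
  simp [mul_single_one_apply, one_apply, ite_mul, mul_ite]

end Matrix

/-- The decomposition of a Choi matrix that is nonnegative on the traceless operators, in terms of
an orthonormal system of traceless operators. -/
theorem Matrix.exists_choi_decomposition {d : ℕ} (hd : d ≠ 0)
    {C : Matrix (Fin d × Fin d) (Fin d × Fin d) ℂ}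
    (hC : C.IsHermitian)
    (hpos : ∀ x : Fin d × Fin d → ℂ, ∑ i, x (i, i) = 0 → 0 ≤ (star x ⬝ᵥ C *ᵥ x).re) :
    ∃ (γ : Fin (d ^ 2 - 1) → ℝ) (F : Fin (d ^ 2 - 1) → Op d) (V : Op d), (∀ k, 0 ≤ γ k) ∧
      (∀ k, (F k).trace = 0) ∧
      (∀ j k, ((F j)ᴴ * F k).trace = if j = k then 1 else 0) ∧
      ∀ p q, C p q = ∑ m, (γ m : ℂ) * F m p.1 p.2 * star (F m q.1 q.2) +
        V p.1 p.2 * (1 : Op d) q.1 q.2 + (1 : Op d) p.1 p.2 * star (V q.1 q.2) := by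
  have hpow : 0 < d ^ 2 := by positivity
  have hn : Module.finrank ℂ (EuclideanSpace ℂ (Fin d × Fin d)) = d ^ 2 - 1 + 1 := by
    simp only [finrank_euclideanSpace, Fintype.card_prod, Fintype.card_fin]
    rw [Nat.sub_add_cancel hpow, sq]
  -- Pairing with the vectorized identity is the trace, so `ω^⊥` consists of the `d ^ 2 - 1`
  -- dimensions of traceless operators.
  let ω : EuclideanSpace ℂ (Fin d × Fin d) := WithLp.toLp 2 fun p => (1 : Op d) p.1 p.2
  have hωin (x : EuclideanSpace ℂ (Fin d × Fin d)) : inner ℂ ω x = ∑ i, x (i, i) := by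
    simp [ω, PiLp.inner_apply, Fintype.sum_prod_type, one_apply, apply_ite]
  have hω : ω ≠ 0 := fun h => by
    have h1 := congrArg (fun x : EuclideanSpace ℂ (Fin d × Fin d) =>
      x (⟨0, Nat.pos_of_ne_zero hd⟩, ⟨0, Nat.pos_of_ne_zero hd⟩)) h
    simp [ω] at h1
  obtain ⟨γ, b, v, hγ, hb, hbω, hdec⟩ :=
    (isSymmetric_toEuclideanLin_iff.mpr hC).exists_orthonormal_decomposition hn hω fun w hw => by
      have h1 := hpos w (by rw [← hωin, hw])
      rw [EuclideanSpace.inner_eq_star_dotProduct, dotProduct_comm]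
      exact h1
  refine ⟨γ, fun k => of fun i j => b k (i, j), of fun i j => v (i, j), hγ, fun k => ?_,
    fun j k => ?_, fun p q => ?_⟩
  · rw [← hbω k, hωin]
    rfl
  · rw [← orthonormal_iff_ite.mp hb j k, PiLp.inner_apply, Fintype.sum_prod_type,
      Finset.sum_comm]
    simp [trace, mul_apply, mul_comm]
  · have h1 := congrArg (fun x : EuclideanSpace ℂ (Fin d × Fin d) => x p)
      (hdec (EuclideanSpace.single q 1))
    have hstar : star ((1 : Op d) q.1 q.2) = (1 : Op d) q.1 q.2 := by simp [one_apply, apply_ite]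
    simp only [EuclideanSpace.inner_single_right, toLpLin_apply, PiLp.add_apply, PiLp.smul_apply,
      smul_eq_mul, one_mul, WithLp.ofLp_sum, Finset.sum_apply, PiLp.ofLp_single,
      mulVec_single_one, col_apply] at h1
    rw [h1]
    simp only [of_apply, ω, starRingEnd_apply, hstar]
    have hsum : ∑ m, (γ m : ℂ) * star (b m q) * b m p =
        ∑ m, (γ m : ℂ) * b m p * star (b m q) :=
      Finset.sum_congr rfl fun m _ => mul_right_comm _ _ _
    rw [hsum, mul_comm (v p), mul_comm _ (star (v q))]

/-! ### Diagonal form of the generator. -/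

namespace QuantumDynamicalSemigroup

variable {d : ℕ} (Φ : QuantumDynamicalSemigroup d)

theorem trace_generator {L : Op d → Op d} (hL : Φ.HasGenerator L) (A : Op d) :
    (L A).trace = 0 := by
  have h1 := ((continuous_id.matrix_trace (n := Fin d) (R := ℂ)).tendsto (L A)).comp (hL A)
  refine tendsto_nhds_unique h1 (tendsto_const_nhds.congr fun t => ?_)
  simp [Matrix.trace_smul, Φ.trace_map]

theorem generator_eq_zero {L : Op d → Op d} (hL : Φ.HasGenerator L) {A : Op d}
    (hA : ∀ t, Φ.map t A = A) : L A = 0 := by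
  refine tendsto_nhds_unique (hL A) (tendsto_const_nhds.congr fun t => ?_)
  simp [hA]

theorem tendsto_choi {L : Op d → Op d} (hL : Φ.HasGenerator L) :
    Tendsto (fun t : ℝ≥0 => (t : ℝ)⁻¹ • (Matrix.choi (Φ.map t) - Matrix.choi id)) (𝓝[>] 0)
      (𝓝 (Matrix.choi L)) := by
  refine tendsto_pi_nhds.mpr fun p => tendsto_pi_nhds.mpr fun q => ?_
  exact ((continuous_id.matrix_elem p.1 q.1).tendsto _).comp (hL (Matrix.single p.2 q.2 1))

theorem choi_id_apply (p q : Fin d × Fin d) :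
    Matrix.choi (id : Op d → Op d) p q = (1 : Op d) p.1 p.2 * (1 : Op d) q.1 q.2 := by
  rw [Matrix.choi, Matrix.of_apply, id, Matrix.single_apply, Matrix.one_apply, Matrix.one_apply]
  split_ifs <;> simp_all

theorem isHermitian_choi_generator {L : Op d → Op d} (hL : Φ.HasGenerator L) :
    (Matrix.choi L).IsHermitian := by
  have h1 := Φ.tendsto_choi hL
  refine tendsto_nhds_unique (((continuous_id.matrix_conjTranspose).tendsto _).comp h1)
    (h1.congr fun t => ?_)
  have hid : (Matrix.choi (id : Op d → Op d))ᴴ = Matrix.choi id := by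
    ext p q
    rw [Matrix.conjTranspose_apply, choi_id_apply, choi_id_apply, Matrix.one_apply,
      Matrix.one_apply]
    split_ifs <;> simp
  simp [Matrix.conjTranspose_smul, hid, (Matrix.posSemidef_choi (Φ.map t)).isHermitian.eq]

/-- The Choi matrix of the identity is `|ω⟩⟨ω|`, which kills `x`; what remains of the difference
quotient is nonnegative by complete positivity. -/
theorem choi_generator_nonneg {L : Op d → Op d} (hL : Φ.HasGenerator L)
    (x : Fin d × Fin d → ℂ) (hx : ∑ i, x (i, i) = 0) :
    0 ≤ (star x ⬝ᵥ Matrix.choi L *ᵥ x).re := by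
  have hc : Continuous fun M : Matrix (Fin d × Fin d) (Fin d × Fin d) ℂ =>
      (star x ⬝ᵥ M *ᵥ x).re := by fun_prop
  refine ge_of_tendsto' ((hc.tendsto _).comp (Φ.tendsto_choi hL)) fun t => ?_
  have hid : Matrix.choi (id : Op d → Op d) *ᵥ x = 0 := by
    ext p
    have h2 : ∑ q : Fin d × Fin d, (1 : Op d) q.1 q.2 * x q = 0 := by
      rw [← hx, Fintype.sum_prod_type]
      simp [Matrix.one_apply]
    simp only [Matrix.mulVec, dotProduct, choi_id_apply, mul_assoc, ← Finset.mul_sum, h2,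
      mul_zero, Pi.zero_apply]
  have h1 := (Matrix.posSemidef_choi (Φ.map t)).re_dotProduct_nonneg x
  simp only [Function.comp_apply, Matrix.smul_mulVec, Matrix.sub_mulVec, hid, sub_zero,
    dotProduct_smul, Complex.smul_re, smul_eq_mul]
  exact mul_nonneg (by positivity) h1

/-- The Gorini–Kossakowski–Sudarshan–Lindblad theorem. -/
theorem exists_diagonalGenerator (hd : d ≠ 0) :
    ∃ (H : Op d) (γ : Fin (d ^ 2 - 1) → ℝ) (F : Fin (d ^ 2 - 1) → Op d),
      Φ.HasGenerator (diagonalGenerator H γ F) ∧ H.IsHermitian ∧ H.trace = 0 ∧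
      (∀ k, 0 ≤ γ k) ∧ (∀ k, (F k).trace = 0) ∧
      (∀ j k, ((F j)ᴴ * F k).trace = if j = k then 1 else 0) := by
  obtain ⟨G, hG⟩ := Φ.exists_hasGenerator
  obtain ⟨γ, F, V, hγ, hF, hFF, hdec⟩ := Matrix.exists_choi_decomposition hd
    (Φ.isHermitian_choi_generator hG) (Φ.choi_generator_nonneg hG)
  have hGA := Matrix.eq_of_choi_eq (G : Op d →ₗ[ℂ] Op d) γ F V hdec
  set K : Op d := ∑ m, (γ m : ℂ) • ((F m)ᴴ * F m) with hK
  -- Trace preservation, tested against all `A`.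
  have hKV : K + V + Vᴴ = 0 := by
    refine (Matrix.ext_iff_trace_mul_right).mpr fun A => ?_
    have h1 := Φ.trace_generator hG A
    rw [show G A = _ from hGA A] at h1
    rw [zero_mul, Matrix.trace_zero, ← h1]
    simp only [hK, add_mul, Matrix.trace_add, Finset.sum_mul, Matrix.trace_sum, smul_mul_assoc,
      Matrix.trace_smul]
    rw [Matrix.trace_mul_comm Vᴴ A]
    have hcycle (m : Fin (d ^ 2 - 1)) :
        ((F m)ᴴ * F m * A).trace = (F m * A * (F m)ᴴ).trace := 
      (Matrix.trace_mul_cycle (F m) A (F m)ᴴ).symm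
    simp only [hcycle]
  have hdne : (d : ℂ) ≠ 0 := Nat.cast_ne_zero.mpr hd
  set H' : Op d := (Complex.I / 2) • (V - Vᴴ) with hH'
  have hH'h : H'ᴴ = H' := by
    rw [hH', Matrix.conjTranspose_smul, Matrix.conjTranspose_sub, Matrix.conjTranspose_conjTranspose]
    simp only [star_div₀, Complex.star_def, Complex.conj_I, Complex.conj_ofNat]
    module
  have hVK : V = -(1 / 2 : ℂ) • K - Complex.I • H' := by
    have : K = -V - Vᴴ := by rw [← sub_eq_zero, ← hKV]; abel
    rw [this, hH', smul_smul, show Complex.I * (Complex.I / 2) = -(1 / 2) by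
      rw [mul_div_assoc', Complex.I_mul_I]; norm_num]
    module
  have hKh : Kᴴ = K := by
    simp [hK, Matrix.conjTranspose_sum, Matrix.conjTranspose_smul]
  have hVK' : Vᴴ = -(1 / 2 : ℂ) • K + Complex.I • H' := by
    rw [hVK]
    simp only [Matrix.conjTranspose_sub, Matrix.conjTranspose_smul, hKh, hH'h]
    simp
  -- Subtracting a scalar makes the Hamiltonian traceless without changing the commutator.
  refine ⟨H' - ((d : ℂ)⁻¹ * H'.trace) • 1, γ, F, fun A => ?_, ?_, ?_, hγ, hF, hFF⟩
  · convert hG A using 2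
    rw [show G A = _ from hGA A, hVK', hVK, diagonalGenerator]
    have hsum : ∑ k, (γ k : ℂ) • (F k * A * (F k)ᴴ -
        (1 / 2 : ℂ) • ((F k)ᴴ * F k * A + A * ((F k)ᴴ * F k))) =
        ∑ k, (γ k : ℂ) • (F k * A * (F k)ᴴ) - (1 / 2 : ℂ) • (K * A + A * K) := by
      rw [hK, Finset.sum_mul, Finset.mul_sum, ← Finset.sum_add_distrib, Finset.smul_sum,
        ← Finset.sum_sub_distrib]
      refine Finset.sum_congr rfl fun k _ => ?_
      rw [smul_mul_assoc, mul_smul_comm]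
      module
    rw [hsum]
    simp only [sub_mul, mul_sub, mul_add, smul_mul_assoc, mul_smul_comm, one_mul, mul_one]
    module
  · have h1 : star H'.trace = H'.trace := by rw [← Matrix.trace_conjTranspose, hH'h]
    rw [Matrix.IsHermitian, Matrix.conjTranspose_sub, hH'h, Matrix.conjTranspose_smul, star_mul',
      h1]
    simp
  · simp [Matrix.trace_sub, Matrix.trace_smul]
    field_simp
    simp

theorem diagonalGenerator_one (H : Op d) (γ : Fin (d ^ 2 - 1) → ℝ) (F : Fin (d ^ 2 - 1) → Op d) :
    diagonalGenerator H γ F 1 =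
      ∑ k, (γ k : ℂ) • (F k * (F k)ᴴ) - ∑ k, (γ k : ℂ) • ((F k)ᴴ * F k) := by
  rw [diagonalGenerator, ← Finset.sum_sub_distrib, mul_one, one_mul, sub_self, smul_zero, zero_add]
  refine Finset.sum_congr rfl fun k _ => ?_
  rw [mul_one, mul_one, one_mul]
  module

end QuantumDynamicalSemigroup

theorem mainTheorem5 (d : ℕ) (hd : 2 ≤ d) (Φ : QuantumDynamicalSemigroup d) (e : EntropyLabel) :
    Φ.DoesNotDecrease e.entropy ↔
      ∃ (H : Op d) (γ : Fin (d ^ 2 - 1) → ℝ) (F : Fin (d ^ 2 - 1) → Op d),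
        Φ.HasGenerator (diagonalGenerator H γ F) ∧
        H.IsHermitian ∧ H.trace = 0 ∧
        (∀ k, 0 ≤ γ k) ∧
        (∀ k, (F k).trace = 0) ∧
        (∀ j k, ((F j)ᴴ * F k).trace = if j = k then 1 else 0) ∧
        ∑ k, (γ k : ℂ) • (F k * (F k)ᴴ) = ∑ k, (γ k : ℂ) • ((F k)ᴴ * F k) := by
  have hd0 : d ≠ 0 := by omega
  constructor
  · intro h
    obtain ⟨H, γ, F, hG, hH, hHtr, hγ, hF, hFF⟩ := Φ.exists_diagonalGenerator hd0
    refine ⟨H, γ, F, hG, hH, hHtr, hγ, hF, hFF, ?_⟩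
    rw [← sub_eq_zero, ← QuantumDynamicalSemigroup.diagonalGenerator_one H]
    exact Φ.generator_eq_zero hG (Φ.map_one_of_doesNotDecrease hd0 h)
  · rintro ⟨H, γ, F, hG, -, -, -, -, -, hsum⟩
    refine Φ.doesNotDecrease_of_map_one (Φ.map_eq_of_generator_eq_zero hG ?_) e
    rw [QuantumDynamicalSemigroup.diagonalGenerator_one, hsum, sub_self]
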